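/- Let $a<b$ be real numbers, $\Delta=[a,b]$, and let $\Psi\in C^1(\Delta,\mathbb R)$ be increasing with $\Psi'(t)\neq 0$ for all $t\in\Delta$. For $\alpha>0$ let $$\mathbf I^{\alpha;\Psi}_{a+}x(t)=\frac1{\Gamma(\alpha)}\int_a^t\Psi'(s)\,(\Psi(t)-\Psi(s))^{\alpha-1}x(s)\,ds,$$ let $\mathbf I^{0;\Psi}_{a+}x=x$, and let $\mathbf I^{\alpha;\Psi}_{a+}x(a)$ denote $\lim_{t\to a+}\mathbf I^{\alpha;\Psi}_{a+}x(t)$. Let $0<\mu\le 1$, $0\le\nu\le 1$, $\varepsilon=\mu+\nu(1-\mu)$, and let $${}^{\mathbf H}\mathfrak D^{\mu,\nu;\Psi}_{a+}x=\mathbf I_{a+}^{\nu(1-\mu);\Psi}\Big(\frac1{\Psi'(t)}\frac{d}{dt}\Big)\mathbf I_{a+}^{(1-\nu)(1-\mu);\Psi}x$$ be the $\Psi$-Hilfer fractional derivative. It is said to exist on $(a,b]$ if for every $t\in(a,b]$ both integrals converge absolutely and the inner function $\mathbf I_{a+}^{(1-\nu)(1-\mu);\Psi}x$ is differentiable at $t$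 (from the left if $t=b$). For $\xi>0$ let $C_{\xi,\mu,\Psi}(\Delta,\mathbb R)$ be the space of continuous functions $x:\Delta\to\mathbb R$ with $\sup_{t\in\Delta}|x(t)|/\mathcal E_\mu(\xi(\Psi(t)-\Psi(a))^\mu)<\infty$, where $\mathcal E_\mu(z)=\sum_{k\ge0}z^k/\Gamma(\mu k+1)$, with the pointwise order. Let $f:\Delta\times\mathbb R\to\mathbb R$ and $\mathcal U:C_{\xi,\mu,\Psi}(\Delta,\mathbb R)\to C_{\xi,\mu,\Psi}(\Delta,\mathbb R)$ be such that, for some constants $L_f,L_{\mathcal U}>0$ with $L_{\mathcal U}+L_f<\xi$: * $(C_1)$ $|f(t,u_1)-f(t,u_2)|\le L_f|u_1-u_2|$ for all $t\in\Delta$, $u_1,u_2\in\mathbb R$; * $(C_2)$ $\mathcal U$ is an abstract Volterra operator (if $x=y$ on $[a,t]$, then $\mathcal U(x)=\mathcal U(y)$ on $[a,t]$), and $|\mathcal U(x)(t)-\mathcal U(y)(t)|\le L_{\mathcal U}|x(t)-y(t)|$ for all $x,y\in C_{\xi,\mu,\Psi}(\Delta,\mathbb R)$, $t\in\Delta$;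 * $f(t,\cdot)$ is increasing (non-decreasing) for every $t\in\Delta$, and $\mathcal U$ is increasing ($x\le y$ implies $\mathcal U(x)\le\mathcal U(y)$). Let $x,y\in C_{\xi,\mu,\Psi}(\Delta,\mathbb R)$ be functions whose $\Psi$-Hilfer derivatives of order $\mu$ and type $\nu$ exist on $(a,b]$, such that for all $t\in(a,b]$ $${}^{\mathbf H}\mathfrak D^{\mu,\nu;\Psi}_{a+}x(t)=\mathcal U(x)(t)+f(t,x(t)),\qquad {}^{\mathbf H}\mathfrak D^{\mu,\nu;\Psi}_{a+}y(t)\le\mathcal U(y)(t)+f(t,y(t)).$$ Then $\mathbf I^{1-\varepsilon;\Psi}_{a+}y(a)\le\mathbf I^{1-\varepsilon;\Psi}_{a+}x(a)$ implies $y(t)\le x(t)$ for all $t\in[a,b]$. -/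

import Mathlib

/-- The one-parameter Mittag-Leffler function `E_μ(z) = ∑ₖ z ^ k / Γ(μ k + 1)`. -/
noncomputable def mittagLeffler (μ z : ℝ) : ℝ :=
  ∑' k : ℕ, z ^ k / Real.Gamma (μ * k + 1)

/-- The space `C_{ξ,μ,Ψ}([a,b], ℝ)` of the continuous functions `x` on `[a,b]` with
`sup_t |x t| / E_μ(ξ (Ψ t - Ψ a) ^ μ) < ∞`. It is ordered pointwise, as a set of functions. -/
def bieleckiSpace (ξ μ : ℝ) (Ψ : ℝ → ℝ) (a b : ℝ) : Set C(Set.Icc a b, ℝ) :=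
  {x | BddAbove (Set.range fun t : Set.Icc a b =>
    |x t| / mittagLeffler μ (ξ * (Ψ t - Ψ a) ^ μ))}

/-- The derivative `Ψ'` on `[a,b]` (one-sided at the end points). -/
noncomputable def scaleDeriv (Ψ : ℝ → ℝ) (a b t : ℝ) : ℝ :=
  derivWithin Ψ (Set.Icc a b) t

/-- The integrand `Ψ'(s) (Ψ(t) - Ψ(s)) ^ (α - 1) x(s)` of the fractional integral at `t`. -/
noncomputable def fracIntegrand (Ψ : ℝ → ℝ) (a b α : ℝ) (x : ℝ → ℝ) (t s : ℝ) : ℝ :=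
  scaleDeriv Ψ a b s * (Ψ t - Ψ s) ^ (α - 1) * x s

/-- The left-sided Riemann-Liouville fractional integral of order `α ≥ 0` of `x` with respect to
`Ψ` on `[a,b]`; the integral of order `0` is the identity. -/
noncomputable def fracIntegral (Ψ : ℝ → ℝ) (a b α : ℝ) (x : ℝ → ℝ) (t : ℝ) : ℝ :=
  if α = 0 then x t
  else (1 / Real.Gamma α) * ∫ s in a..t, fracIntegrand Ψ a b α x t s

/-- The fractional integral of order `α` of `x` at `t` exists, as a convergent integral. -/
def FracIntegralExists (Ψ : ℝ → ℝ) (a b α : ℝ) (x : ℝ → ℝ) (t : ℝ) : Prop :=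
  α = 0 ∨ IntervalIntegrable (fracIntegrand Ψ a b α x t) MeasureTheory.volume a t

/-- The function `(1 / Ψ') d/dt I^{(1-ν)(1-μ);Ψ} x`. -/
noncomputable def hilferInner (Ψ : ℝ → ℝ) (a b μ ν : ℝ) (x : ℝ → ℝ) (t : ℝ) : ℝ :=
  (1 / scaleDeriv Ψ a b t) *
    derivWithin (fracIntegral Ψ a b ((1 - ν) * (1 - μ)) x) (Set.Icc a b) t

/-- The `Ψ`-Hilfer fractional derivative of order `μ ∈ (0,1]` and type `ν ∈ [0,1]`,
`D^{μ,ν;Ψ} x = I^{ν(1-μ);Ψ} (1 / Ψ' d/dt) I^{(1-ν)(1-μ);Ψ} x`. -/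
noncomputable def hilferDeriv (Ψ : ℝ → ℝ) (a b μ ν : ℝ) (x : ℝ → ℝ) (t : ℝ) : ℝ :=
  fracIntegral Ψ a b (ν * (1 - μ)) (hilferInner Ψ a b μ ν x) t

/-- All the operations in the `Ψ`-Hilfer derivative of `x` are meaningful at every point of
`(a,b]`: the two integrals converge and the derivative between them exists. -/
structure HilferDifferentiable (Ψ : ℝ → ℝ) (a b μ ν : ℝ) (x : ℝ → ℝ) : Prop where
  inner_exists : ∀ t ∈ Set.Ioc a b, FracIntegralExists Ψ a b ((1 - ν) * (1 - μ)) x t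
  differentiable : ∀ t ∈ Set.Ioc a b,
    DifferentiableWithinAt ℝ (fracIntegral Ψ a b ((1 - ν) * (1 - μ)) x) (Set.Icc a b) t
  outer_exists : ∀ t ∈ Set.Ioc a b,
    FracIntegralExists Ψ a b (ν * (1 - μ)) (hilferInner Ψ a b μ ν x) t

/-- `I^{α;Ψ} x (a) = c`, where the value at the base point `a` is the limit from the right. -/
def HasInitialValue (Ψ : ℝ → ℝ) (a b α : ℝ) (x : ℝ → ℝ) (c : ℝ) : Prop :=
  Filter.Tendsto (fracIntegral Ψ a b α x) (nhdsWithin a (Set.Ioi a)) (nhds c)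

/-- `U` is an abstract Volterra (causal, non-anticipatory) operator on a set `S` of continuous
functions on `[a,b]`: on `[a,t]` the function `U x` depends only on the values of `x` on
`[a,t]`. -/
def IsAbstractVolterra {a b : ℝ} {S : Set C(Set.Icc a b, ℝ)} (U : S → S) : Prop :=
  ∀ (x y : S) (t : Set.Icc a b), (∀ s ≤ t, x.1 s = y.1 s) → ∀ s ≤ t, (U x).1 s = (U y).1 s

/-! Put `z = x - y`. Where `z t < 0`, the Lipschitz bounds limit the decrease of the right-hand
side; where `z t ≥ 0`, monotonicity makes its increment nonnegative. For `U` this holds pointwise: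
the Lipschitz bound makes `U x` at `t` depend only on `x t`, so `x ⊔ y` can replace `x`
(`apply_le_apply_of_pointwise_lipschitz`). Hence the Hilfer derivative of `z` is at least `-L w`,
with `L = L_U + L_f` and `w = max (-z) 0`.

In the variable `Ψ t` the operators become Riemann-Liouville integrals `I^γ`. Let `α` and `β` be the
inner and outer orders, so `α + β + μ = 1`, and let `g` be the derivative of `I^α z`. Once `g` is
known to be integrable (`HilferDifferentiable.intervalIntegrable_deriv`), `I^α z = c + I^1 g` with
`c ≥ 0`. Inverting formally, `z` is a nonnegative power term plus `I^μ (I^β g)`, so `z ≥ -L I^μ w`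
and `w ≤ L I^μ w`. Since `I^μ` contracts the weight `exp (θ t)` by `θ ^ (-μ)` (`rlIntegral_le_exp`),
a large `θ` forces `w = 0`.

The inversion is not done pointwise. `nonneg_of_hilfer_inequality` keeps one extra integration, so
that all composed orders are at least `1` and kernels are bounded, and returns to `z` through the
monotonicity of a primitive. -/

section

open MeasureTheory Set Filter Topology

/-! ### Beta integrals and composition of kernels -/

/-- The Euler beta integral over the interval `[r,t]`, with its convergence. -/
theorem beta_integral_scaled {p q r t : ℝ} (hp : 0 < p) (hq : 0 < q) (hrt : r < t) :
    IntervalIntegrable (fun s => (t - s) ^ (p - 1) * (s - r) ^ (q - 1)) volume r t ∧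
    ∫ s in r..t, (t - s) ^ (p - 1) * (s - r) ^ (q - 1) =
      Real.Gamma p * Real.Gamma q / Real.Gamma (p + q) * (t - r) ^ (p + q - 1) := by
  have hd : 0 < t - r := sub_pos.2 hrt
  have key : ∫ x in (0 : ℝ)..(t - r), x ^ (q - 1) * (t - r - x) ^ (p - 1) =
      Real.Gamma p * Real.Gamma q / Real.Gamma (p + q) * (t - r) ^ (p + q - 1) := by
    have h1 := Complex.betaIntegral_scaled (q : ℂ) (p : ℂ) hd
    rw [Complex.betaIntegral_eq_Gamma_mul_div _ _ (by simpa) (by simpa)] at h1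
    have h2 : (∫ x in (0 : ℝ)..(t - r), (x : ℂ) ^ ((q : ℂ) - 1) *
        (((t - r : ℝ) : ℂ) - x) ^ ((p : ℂ) - 1)) =
        ((∫ x in (0 : ℝ)..(t - r), x ^ (q - 1) * (t - r - x) ^ (p - 1) : ℝ) : ℂ) := by
      rw [← intervalIntegral.integral_ofReal]
      refine intervalIntegral.integral_congr fun x hx => ?_
      rw [uIcc_of_le hd.le] at hx
      push_cast
      rw [Complex.ofReal_cpow hx.1, Complex.ofReal_cpow (sub_nonneg.2 hx.2)]
      push_cast
      rfl
    rw [h2] at h1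
    have h3 : ((t - r : ℝ) : ℂ) ^ ((q : ℂ) + p - 1) = (((t - r) ^ (p + q - 1) : ℝ) : ℂ) := by
      rw [Complex.ofReal_cpow hd.le]
      congr 1
      push_cast
      ring
    rw [h3, ← Complex.ofReal_add, Complex.Gamma_ofReal, Complex.Gamma_ofReal,
      Complex.Gamma_ofReal] at h1
    have h4 : (∫ x in (0 : ℝ)..(t - r), x ^ (q - 1) * (t - r - x) ^ (p - 1)) =
      (t - r) ^ (p + q - 1) * (Real.Gamma q * Real.Gamma p / Real.Gamma (q + p)) := by
      exact_mod_cast h1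
    rw [h4, add_comm q p]
    ring
  have h5 : ∫ s in r..t, (t - s) ^ (p - 1) * (s - r) ^ (q - 1) =
      Real.Gamma p * Real.Gamma q / Real.Gamma (p + q) * (t - r) ^ (p + q - 1) := by
    rw [← key]
    have := intervalIntegral.integral_comp_sub_right (a := r) (b := t)
      (fun x : ℝ => x ^ (q - 1) * (t - r - x) ^ (p - 1)) r
    rw [sub_self] at this
    rw [← this]
    refine intervalIntegral.integral_congr fun x _ => ?_
    simp only [sub_sub_sub_cancel_right]
    ring
  refine ⟨?_, h5⟩
  -- A non-integrable function has integral `0` by convention, but the value just computed is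
  -- positive.
  by_contra hni
  rw [intervalIntegral.integral_undef hni] at h5
  have := Real.Gamma_pos_of_pos hp
  have := Real.Gamma_pos_of_pos hq
  have := Real.Gamma_pos_of_pos (add_pos hp hq)
  have := Real.rpow_pos_of_pos hd (p + q - 1)
  have : 0 < Real.Gamma p * Real.Gamma q / Real.Gamma (p + q) * (t - r) ^ (p + q - 1) := by
    positivity
  linarith

/-- The kernel `(t - s) ^ (γ - 1)` is bounded for `γ ≥ 1`, so it preserves integrability. -/
theorem intervalIntegrable_rpow_mul {A t γ : ℝ} (hγ : 1 ≤ γ) {u : ℝ → ℝ}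
    (hu : IntervalIntegrable u volume A t) :
    IntervalIntegrable (fun s => (t - s) ^ (γ - 1) * u s) volume A t :=
  hu.continuousOn_mul <|
    Continuous.continuousOn <| (continuous_const.sub continuous_id).rpow_const
      fun _ => Or.inr (by linarith)

/-- Composition of two Riemann-Liouville kernels. -/
theorem rpow_kernel_comp {A t p q : ℝ} (hAt : A ≤ t) (hp : 0 < p) (hq : 0 < q)
    (hpq : 1 ≤ p + q) {u : ℝ → ℝ} (hu : IntervalIntegrable u volume A t) :
    IntervalIntegrable (fun s => (t - s) ^ (p - 1) * ∫ r in A..s, (s - r) ^ (q - 1) * u r)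
      volume A t ∧
    ∫ s in A..t, (t - s) ^ (p - 1) * ∫ r in A..s, (s - r) ^ (q - 1) * u r =
      Real.Gamma p * Real.Gamma q / Real.Gamma (p + q) *
        ∫ r in A..t, (t - r) ^ (p + q - 1) * u r := by
  classical
  set C := Real.Gamma p * Real.Gamma q / Real.Gamma (p + q) with hC
  set m : Measure ℝ := volume.restrict (Ioc A t) with hm
  -- Cutting the kernel off to the triangle `r < s` turns the iterated integral into one over a
  -- square, where Fubini applies.
  set k : ℝ × ℝ → ℝ := fun z =>
    if z.2 < z.1 then (t - z.1) ^ (p - 1) * (z.1 - z.2) ^ (q - 1) else 0 with hk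
  have hkm : Measurable k := by
    refine Measurable.ite (measurableSet_lt measurable_snd measurable_fst) ?_ measurable_const
    fun_prop
  have hu' : Integrable u m := by
    rwa [intervalIntegrable_iff_integrableOn_Ioc_of_le hAt] at hu
  have hmeas : AEStronglyMeasurable (fun z : ℝ × ℝ => k z * u z.2) (m.prod m) :=
    hkm.aestronglyMeasurable.mul hu'.aestronglyMeasurable.comp_snd
  have hkr : ∀ r ∈ Ioo A t, (fun s => k (s, r)) =
      (Ioi r).indicator fun s => (t - s) ^ (p - 1) * (s - r) ^ (q - 1) := by
    intro r _
    ext s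
    simp only [hk, indicator, mem_Ioi]
  have hres : ∀ r ∈ Ioo A t, m.restrict (Ioi r) = volume.restrict (Ioc r t) := by
    intro r hr
    rw [hm, Measure.restrict_restrict measurableSet_Ioi]
    congr 1
    ext s
    simp only [mem_inter_iff, mem_Ioi, mem_Ioc]
    exact ⟨fun h => ⟨h.1, h.2.2⟩, fun h => ⟨h.1, hr.1.trans h.1, h.2⟩⟩
  have hint : ∀ r ∈ Ioo A t, Integrable (fun s => k (s, r)) m := by
    intro r hr
    rw [hkr r hr, integrable_indicator_iff measurableSet_Ioi, IntegrableOn, hres r hr]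
    exact (intervalIntegrable_iff_integrableOn_Ioc_of_le hr.2.le).1
      (beta_integral_scaled hp hq hr.2).1
  have hval : ∀ r ∈ Ioo A t, ∫ s, k (s, r) ∂m = C * (t - r) ^ (p + q - 1) := by
    intro r hr
    rw [hkr r hr, integral_indicator measurableSet_Ioi, hres r hr,
      ← intervalIntegral.integral_of_le hr.2.le, (beta_integral_scaled hp hq hr.2).2]
  have hae : ∀ᵐ r ∂m, r ∈ Ioo A t := by
    rw [hm, ← restrict_Ioo_eq_restrict_Ioc]
    exact ae_restrict_mem measurableSet_Ioo
  have hkn : ∀ s ∈ Ioo A t, ∀ r, 0 ≤ k (s, r) := by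
    intro s hs r
    simp only [hk]
    split_ifs with h
    · exact mul_nonneg (Real.rpow_nonneg (by linarith [hs.2]) _)
        (Real.rpow_nonneg (by linarith) _)
    · exact le_rfl
  have hK : Integrable (fun z : ℝ × ℝ => k z * u z.2) (m.prod m) := by
    rw [integrable_prod_iff' hmeas]
    constructor
    · filter_upwards [hae] with r hr
      exact (hint r hr).mul_const _
    -- The kernel is nonnegative, so integrating the norm in `s` gives the beta value times `‖u r‖`;
    -- `1 ≤ p + q` keeps this factor bounded.
    · have h1 : IntervalIntegrable (fun r => C * ((t - r) ^ (p + q - 1) * ‖u r‖)) volume A t :=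
        (intervalIntegrable_rpow_mul hpq hu.norm).const_mul C
      rw [intervalIntegrable_iff_integrableOn_Ioc_of_le hAt] at h1
      refine h1.congr ?_
      filter_upwards [hae] with r hr
      rw [← mul_assoc, ← hval r hr, ← integral_mul_const]
      refine integral_congr_ae ?_
      filter_upwards [hae] with s hs
      rw [norm_mul, Real.norm_of_nonneg (hkn s hs r)]
  have hinner : ∀ s ∈ Ioc A t, ∫ r, k (s, r) * u r ∂m =
      (t - s) ^ (p - 1) * ∫ r in A..s, (s - r) ^ (q - 1) * u r := by
    intro s hs
    have h1 : (fun r => k (s, r) * u r) =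
        (Iio s).indicator fun r => (t - s) ^ (p - 1) * ((s - r) ^ (q - 1) * u r) := by
      ext r
      simp only [hk, indicator, mem_Iio]
      split_ifs <;> ring
    have h2 : m.restrict (Iio s) = volume.restrict (Ioo A s) := by
      rw [hm, Measure.restrict_restrict measurableSet_Iio]
      congr 1
      ext r
      simp only [mem_inter_iff, mem_Iio, mem_Ioc, mem_Ioo]
      exact ⟨fun h => ⟨h.2.1, h.1⟩, fun h => ⟨h.2, h.1, h.2.le.trans hs.2⟩⟩
    rw [h1, integral_indicator measurableSet_Iio, h2, restrict_Ioo_eq_restrict_Ioc,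
      integral_const_mul, intervalIntegral.integral_of_le hs.1.le]
  have hin : (fun s => ∫ r, k (s, r) * u r ∂m) =ᵐ[m]
      fun s => (t - s) ^ (p - 1) * ∫ r in A..s, (s - r) ^ (q - 1) * u r := by
    filter_upwards [ae_restrict_mem measurableSet_Ioc] with s hs using hinner s hs
  constructor
  · rw [intervalIntegrable_iff_integrableOn_Ioc_of_le hAt]
    exact hK.integral_prod_left.congr hin
  · rw [intervalIntegral.integral_of_le hAt, intervalIntegral.integral_of_le hAt,
      ← integral_congr_ae hin, integral_integral_swap (f := fun s r => k (s, r) * u r) hK,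
      ← integral_const_mul]
    refine integral_congr_ae ?_
    filter_upwards [hae] with r hr
    rw [integral_mul_const, hval r hr, mul_assoc]

/-! ### Riemann-Liouville integrals -/

/-- The Riemann-Liouville integral of order `α` based at `A`; of order `0` it is the identity. -/
noncomputable def rlIntegral (A α : ℝ) (u : ℝ → ℝ) (t : ℝ) : ℝ :=
  if α = 0 then u t else 1 / Real.Gamma α * ∫ s in A..t, (t - s) ^ (α - 1) * u s

theorem rlIntegral_zero (A : ℝ) (u : ℝ → ℝ) (t : ℝ) : rlIntegral A 0 u t = u t := if_pos rfl

theorem rlIntegral_of_ne {A α : ℝ} (hα : α ≠ 0) (u : ℝ → ℝ) (t : ℝ) :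
    rlIntegral A α u t = 1 / Real.Gamma α * ∫ s in A..t, (t - s) ^ (α - 1) * u s := if_neg hα

theorem rlIntegral_one (A : ℝ) (u : ℝ → ℝ) (t : ℝ) :
    rlIntegral A 1 u t = ∫ s in A..t, u s := by
  simp [rlIntegral_of_ne one_ne_zero]

theorem rlIntegral_congr {A α t : ℝ} (hAt : A ≤ t) (hα : α ≠ 0) {u v : ℝ → ℝ}
    (h : ∀ s ∈ Ioc A t, u s = v s) : rlIntegral A α u t = rlIntegral A α v t := by
  rw [rlIntegral_of_ne hα, rlIntegral_of_ne hα, intervalIntegral.integral_of_le hAt,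
    intervalIntegral.integral_of_le hAt]
  congr 1
  exact setIntegral_congr_fun measurableSet_Ioc fun s hs => by simp only [h s hs]

theorem rlIntegral_add {A α t : ℝ} {u v : ℝ → ℝ}
    (hu : IntervalIntegrable (fun s => (t - s) ^ (α - 1) * u s) volume A t)
    (hv : IntervalIntegrable (fun s => (t - s) ^ (α - 1) * v s) volume A t) :
    rlIntegral A α (fun s => u s + v s) t = rlIntegral A α u t + rlIntegral A α v t := by
  by_cases hα : α = 0
  · simp [hα, rlIntegral_zero]
  · simp only [rlIntegral_of_ne hα, mul_add]
    rw [intervalIntegral.integral_add hu hv, mul_add]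

theorem rlIntegral_const_mul (A α t c : ℝ) (u : ℝ → ℝ) :
    rlIntegral A α (fun s => c * u s) t = c * rlIntegral A α u t := by
  by_cases hα : α = 0
  · simp [hα, rlIntegral_zero]
  · simp only [rlIntegral_of_ne hα, mul_left_comm _ c]
    rw [intervalIntegral.integral_const_mul]
    ring

/-- The semigroup property of the Riemann-Liouville integrals, for a total order at least `1`. -/
theorem rlIntegral_comp {A t p q : ℝ} (hAt : A ≤ t) (hp : 0 < p) (hq : 0 ≤ q)
    (hpq : 1 ≤ p + q) {u : ℝ → ℝ} (hu : IntervalIntegrable u volume A t) :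
    IntervalIntegrable (fun s => (t - s) ^ (p - 1) * rlIntegral A q u s) volume A t ∧
    rlIntegral A p (rlIntegral A q u) t = rlIntegral A (p + q) u t := by
  rcases hq.eq_or_lt with rfl | hq
  · rw [add_zero] at hpq ⊢
    simp only [show rlIntegral A 0 u = u from funext fun s => rlIntegral_zero A u s]
    exact ⟨intervalIntegrable_rpow_mul hpq hu, trivial⟩
  · obtain ⟨h1, h2⟩ := rpow_kernel_comp hAt hp hq hpq hu
    have hΓp := (Real.Gamma_pos_of_pos hp).ne'
    have hΓq := (Real.Gamma_pos_of_pos hq).ne'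
    have hΓ := (Real.Gamma_pos_of_pos (add_pos hp hq)).ne'
    simp only [rlIntegral_of_ne hq.ne', rlIntegral_of_ne hp.ne',
      rlIntegral_of_ne (add_pos hp hq).ne', mul_left_comm _ (1 / Real.Gamma q)]
    refine ⟨h1.const_mul _, ?_⟩
    rw [intervalIntegral.integral_const_mul, h2]
    field_simp

/-- For `γ ≥ 1` the kernel `(t - r) ^ (γ - 1)` grows with `t`, and enlarging the interval only adds
a nonnegative contribution. -/
theorem rlIntegral_monotoneOn {A B γ : ℝ} (hγ : 1 ≤ γ) {u : ℝ → ℝ}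
    (hu : IntervalIntegrable u volume A B) (h : ∀ s ∈ Ioc A B, 0 ≤ u s) :
    MonotoneOn (rlIntegral A γ u) (Icc A B) := by
  intro s hs t ht hst
  have hγ0 : 0 < γ := by linarith
  simp only [rlIntegral_of_ne hγ0.ne']
  refine mul_le_mul_of_nonneg_left ?_ (one_div_nonneg.2 (Real.Gamma_pos_of_pos hγ0).le)
  have hAB : A ≤ B := hs.1.trans hs.2
  have hut : IntervalIntegrable u volume A t :=
    hu.mono_set (by rw [uIcc_of_le ht.1, uIcc_of_le hAB]; exact Icc_subset_Icc_right ht.2)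
  have hus : IntervalIntegrable u volume A s :=
    hu.mono_set (by rw [uIcc_of_le hs.1, uIcc_of_le hAB]; exact Icc_subset_Icc_right hs.2)
  have hkt := intervalIntegrable_rpow_mul hγ hut
  have hks := intervalIntegrable_rpow_mul hγ hus
  have hkts : IntervalIntegrable (fun r => (t - r) ^ (γ - 1) * u r) volume A s :=
    hkt.mono_set (by rw [uIcc_of_le ht.1, uIcc_of_le hs.1]; exact Icc_subset_Icc_right hst)
  have hktt : IntervalIntegrable (fun r => (t - r) ^ (γ - 1) * u r) volume s t :=
    hkt.mono_set (by rw [uIcc_of_le ht.1, uIcc_of_le hst]; exact Icc_subset_Icc_left hs.1)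
  rw [← intervalIntegral.integral_add_adjacent_intervals hkts hktt]
  have h1 : ∫ r in A..s, (s - r) ^ (γ - 1) * u r ≤ ∫ r in A..s, (t - r) ^ (γ - 1) * u r := by
    refine intervalIntegral.integral_mono_on_of_le_Ioo hs.1 hks hkts fun r hr => ?_
    refine mul_le_mul_of_nonneg_right ?_ (h r ⟨hr.1, hr.2.le.trans hs.2⟩)
    exact Real.rpow_le_rpow (by linarith [hr.2]) (by linarith) (by linarith)
  have h2 : 0 ≤ ∫ r in s..t, (t - r) ^ (γ - 1) * u r := by
    rw [intervalIntegral.integral_of_le hst]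
    exact setIntegral_nonneg measurableSet_Ioc fun r hr => mul_nonneg
      (Real.rpow_nonneg (sub_nonneg.2 hr.2) _) (h r ⟨hs.1.trans_lt hr.1, hr.2.trans ht.2⟩)
  linarith

theorem intervalIntegrable_rpow_sub {A t p : ℝ} (hp : 0 < p) :
    IntervalIntegrable (fun s => (t - s) ^ (p - 1)) volume A t := by
  have := (intervalIntegral.intervalIntegrable_rpow' (a := t - A) (b := t - t)
    (show -1 < p - 1 by linarith)).comp_sub_left t
  simpa using this

theorem rlIntegral_const {A t p : ℝ} (hp : 0 < p) (c : ℝ) :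
    rlIntegral A p (fun _ => c) t = c / Real.Gamma (p + 1) * (t - A) ^ p := by
  have hΓ := (Real.Gamma_pos_of_pos hp).ne'
  have h := intervalIntegral.integral_comp_sub_left (a := A) (b := t)
    (fun x : ℝ => x ^ (p - 1)) t
  rw [sub_self, integral_rpow (Or.inl (by linarith))] at h
  rw [rlIntegral_of_ne hp.ne', intervalIntegral.integral_mul_const, h, sub_add_cancel,
    Real.zero_rpow hp.ne', Real.Gamma_add_one hp.ne']
  field_simp
  ring_nf

/-- The Riemann-Liouville integral of order `μ` contracts exponential growth of rate `θ` by the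
factor `θ ^ (-μ)`. -/
theorem rlIntegral_le_exp {A t μ θ m : ℝ} (hAt : A ≤ t) (hμ : 0 < μ) (hθ : 0 < θ) (hm : 0 ≤ m)
    {w : ℝ → ℝ} (hw : Continuous w) (hwm : ∀ s ∈ Icc A t, w s ≤ m * Real.exp (θ * s)) :
    rlIntegral A μ w t ≤ (1 / θ) ^ μ * m * Real.exp (θ * t) := by
  have hΓ := Real.Gamma_pos_of_pos hμ
  have hk := intervalIntegrable_rpow_sub (A := A) (t := t) hμ
  have hint : IntervalIntegrable (fun x : ℝ => x ^ (μ - 1) * Real.exp (-(θ * x))) volume 0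
      (t - A) :=
    (intervalIntegral.intervalIntegrable_rpow' (by linarith)).mul_continuousOn (by fun_prop)
  have h1 : ∫ s in A..t, (t - s) ^ (μ - 1) * w s ≤
      ∫ s in A..t, (t - s) ^ (μ - 1) * (m * Real.exp (θ * s)) := by
    refine intervalIntegral.integral_mono_on hAt (hk.mul_continuousOn hw.continuousOn)
      (hk.mul_continuousOn (by fun_prop)) fun s hs => ?_
    exact mul_le_mul_of_nonneg_left (hwm s hs) (Real.rpow_nonneg (sub_nonneg.2 hs.2) _)
  have h2 : ∫ s in A..t, (t - s) ^ (μ - 1) * (m * Real.exp (θ * s)) =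
      m * Real.exp (θ * t) * ∫ x in (0 : ℝ)..(t - A), x ^ (μ - 1) * Real.exp (-(θ * x)) := by
    have h := intervalIntegral.integral_comp_sub_left (a := A) (b := t)
      (fun x : ℝ => x ^ (μ - 1) * Real.exp (-(θ * x))) t
    rw [sub_self] at h
    rw [← h, ← intervalIntegral.integral_const_mul]
    refine intervalIntegral.integral_congr fun s _ => ?_
    have : Real.exp (θ * s) = Real.exp (θ * t) * Real.exp (-(θ * (t - s))) := by
      rw [← Real.exp_add]
      ring_nf
    simp only [this]
    ring
  have h3 : ∫ x in (0 : ℝ)..(t - A), x ^ (μ - 1) * Real.exp (-(θ * x)) ≤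
      (1 / θ) ^ μ * Real.Gamma μ := by
    rw [← Real.integral_rpow_mul_exp_neg_mul_Ioi hμ hθ,
      intervalIntegral.integral_of_le (sub_nonneg.2 hAt)]
    refine setIntegral_mono_set ?_ ?_ Ioc_subset_Ioi_self.eventuallyLE
    -- Integrability on the half-line again follows from the nonzero value of the Gamma integral.
    · by_contra hni
      have := Real.integral_rpow_mul_exp_neg_mul_Ioi hμ hθ
      rw [integral_undef hni] at this
      have : 0 < (1 / θ) ^ μ * Real.Gamma μ := by positivity
      linarith
    · filter_upwards [ae_restrict_mem measurableSet_Ioi] with x hx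
      exact mul_nonneg (Real.rpow_nonneg (le_of_lt hx) _) (Real.exp_pos _).le
  rw [rlIntegral_of_ne hμ.ne']
  calc 1 / Real.Gamma μ * ∫ s in A..t, (t - s) ^ (μ - 1) * w s
      ≤ 1 / Real.Gamma μ * (m * Real.exp (θ * t) * ((1 / θ) ^ μ * Real.Gamma μ)) := by
        refine mul_le_mul_of_nonneg_left (h1.trans (h2.le.trans ?_)) (by positivity)
        exact mul_le_mul_of_nonneg_left h3 (by positivity)
    _ = (1 / θ) ^ μ * m * Real.exp (θ * t) := by field_simp

/-! ### Comparison principle in the identity scale -/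

/-- A continuous function with a nondecreasing primitive is nonnegative. -/
theorem nonneg_of_monotoneOn_rlIntegral_one {A B : ℝ} (hAB : A < B) {v : ℝ → ℝ}
    (hv : Continuous v) (hmono : MonotoneOn (rlIntegral A 1 v) (Icc A B)) :
    ∀ t ∈ Icc A B, 0 ≤ v t := by
  intro t ht
  have h1 : HasDerivAt (rlIntegral A 1 v) (v t) t := by
    rw [show rlIntegral A 1 v = fun t => ∫ s in A..t, v s from
      funext fun t => rlIntegral_one A v t]
    exact hv.integral_hasStrictDerivAt A t |>.hasDerivAt
  rw [← h1.hasDerivWithinAt.derivWithin (uniqueDiffOn_Icc hAB t ht)]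
  exact hmono.derivWithin_nonneg

/-- A comparison principle for the Hilfer derivative of order `μ` with inner order `α` and outer
order `β`, relative to the identity scale. -/
theorem nonneg_of_hilfer_inequality {A B α β μ c L : ℝ} {Z g : ℝ → ℝ} (hAB : A < B)
    (hα : 0 ≤ α) (hβ : 0 ≤ β) (hμ : 0 < μ) (hsum : α + β + μ = 1) (hc : 0 ≤ c) (hL : 0 ≤ L)
    (hZ : Continuous Z) (hg : IntervalIntegrable g volume A B)
    (hG : ∀ t ∈ Ioc A B, rlIntegral A α Z t = c + rlIntegral A 1 g t)
    (hD : ∀ t ∈ Ioc A B, -(L * max (-Z t) 0) ≤ rlIntegral A β g t) :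
    ∀ t ∈ Icc A B, 0 ≤ Z t := by
  set w : ℝ → ℝ := fun t => max (-Z t) 0 with hw
  have hwc : Continuous w := hZ.neg.max continuous_const
  have hgt : ∀ t ∈ Icc A B, IntervalIntegrable g volume A t := fun t ht =>
    hg.mono_set (by rw [uIcc_of_le ht.1, uIcc_of_le hAB.le]; exact Icc_subset_Icc_right ht.2)
  set h : ℝ → ℝ := rlIntegral A β g with hh
  have hhi : ∀ t ∈ Icc A B, IntervalIntegrable h volume A t := fun t ht => by
    simpa using (rlIntegral_comp ht.1 one_pos hβ (by linarith) (hgt t ht)).1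
  have hwi : ∀ t, IntervalIntegrable w volume A t := fun t => hwc.intervalIntegrable _ _
  have hJw : ∀ t ∈ Icc A B, IntervalIntegrable (rlIntegral A μ w) volume A t := fun t ht => by
    simpa using (rlIntegral_comp ht.1 one_pos hμ.le (by linarith) (hwi t)).1
  -- Apply `I^(1-α)` to `hG`. The `g` term has order `2 - α = 1 + μ + β`, hence equals `I^(1+μ) h`;
  -- adding and subtracting `L w` isolates the nonnegative function `h + L w`.
  have hrepr : ∀ t ∈ Icc A B, rlIntegral A 1 Z t =
      c / Real.Gamma (1 - α + 1) * (t - A) ^ (1 - α) +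
        rlIntegral A (1 + μ) (fun s => h s + L * w s) t -
        L * rlIntegral A 1 (rlIntegral A μ w) t := by
    intro t ht
    have hα1 : 0 < 1 - α := by linarith
    have e1 := (rlIntegral_comp ht.1 hα1 hα (by linarith) (hZ.intervalIntegrable A t)).2
    have e2 := rlIntegral_comp ht.1 hα1 zero_le_one (by linarith) (hgt t ht)
    have e3 := (rlIntegral_comp ht.1 (show 0 < 1 + μ by linarith) hβ (by linarith)
      (hgt t ht)).2
    have e4 := (rlIntegral_comp ht.1 one_pos hμ.le (by linarith) (hwi t)).2
    have e5 := rlIntegral_add (α := 1 + μ) (t := t) (A := A) (u := h) (v := fun s => L * w s)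
      (intervalIntegrable_rpow_mul (by linarith) (hhi t ht))
      (intervalIntegrable_rpow_mul (by linarith) ((hwi t).const_mul L))
    rw [rlIntegral_const_mul] at e5
    have e6 : rlIntegral A (1 - α) (rlIntegral A α Z) t =
        rlIntegral A (1 - α) (fun s => c + rlIntegral A 1 g s) t :=
      rlIntegral_congr ht.1 hα1.ne' fun s hs => hG s ⟨hs.1, hs.2.trans ht.2⟩
    rw [rlIntegral_add ((intervalIntegrable_rpow_sub hα1).mul_const c) e2.1,
      rlIntegral_const hα1, e2.2] at e6
    rw [sub_add_cancel] at e1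
    rw [e5, e4, ← e1, e6, hh, e3, show 1 + μ + β = 1 - α + 1 by linarith]
    ring
  -- Chosen so that `L * θ ^ (-μ) = L / (2 * L + 1) ≤ 1 / 2`.
  set θ : ℝ := (2 * L + 1) ^ (1 / μ) with hθ
  have hθ0 : 0 < θ := Real.rpow_pos_of_pos (by linarith) _
  have hθμ : (1 / θ) ^ μ = 1 / (2 * L + 1) := by
    rw [one_div, Real.inv_rpow hθ0.le, hθ, ← Real.rpow_mul (by linarith),
      one_div_mul_cancel hμ.ne', Real.rpow_one, one_div]
  have hstep : ∀ m, 0 ≤ m → (∀ t ∈ Icc A B, w t ≤ m * Real.exp (θ * t)) →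
      ∀ t ∈ Icc A B, w t ≤ m / 2 * Real.exp (θ * t) := by
    intro m hm hwm
    set E : ℝ → ℝ := fun t => (1 / θ) ^ μ * m * Real.exp (θ * t) with hE
    have hEc : Continuous E := by fun_prop
    have hJE : ∀ t ∈ Icc A B, rlIntegral A μ w t ≤ E t := fun t ht =>
      rlIntegral_le_exp ht.1 hμ hθ0 hm hwc fun s hs => hwm s ⟨hs.1, hs.2.trans ht.2⟩
    have hv : ∀ t ∈ Icc A B, 0 ≤ Z t + L * E t := by
      -- The primitive of `Z + L E` is a sum of three nondecreasing terms: a power of `t - A`, the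
      -- integral of `h + L w ≥ 0`, and `L` times the integral of `E - I^μ w ≥ 0`.
      refine nonneg_of_monotoneOn_rlIntegral_one hAB (v := fun t => Z t + L * E t)
        (by fun_prop) ?_
      have hm1 : MonotoneOn (rlIntegral A (1 + μ) (fun s => h s + L * w s)) (Icc A B) :=
        rlIntegral_monotoneOn (by linarith)
          ((hhi B ⟨hAB.le, le_rfl⟩).add ((hwi B).const_mul L))
          fun s hs => by linarith [hD s hs]
      have hm2 : MonotoneOn (rlIntegral A 1 (fun s => E s + (-1) * rlIntegral A μ w s))
          (Icc A B) :=
        rlIntegral_monotoneOn le_rfl ((hEc.intervalIntegrable _ _).add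
          ((hJw B ⟨hAB.le, le_rfl⟩).const_mul (-1)))
          fun s hs => by linarith [hJE s ⟨hs.1.le, hs.2⟩]
      have heq : ∀ t ∈ Icc A B, rlIntegral A 1 (fun t => Z t + L * E t) t =
          c / Real.Gamma (1 - α + 1) * (t - A) ^ (1 - α) +
          rlIntegral A (1 + μ) (fun s => h s + L * w s) t +
          L * rlIntegral A 1 (fun s => E s + (-1) * rlIntegral A μ w s) t := by
        intro t ht
        have a1 := rlIntegral_add (α := 1) (t := t) (A := A) (u := Z) (v := fun s => L * E s)
          (intervalIntegrable_rpow_mul le_rfl (hZ.intervalIntegrable _ _))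
          (intervalIntegrable_rpow_mul le_rfl ((hEc.intervalIntegrable _ _).const_mul L))
        have a2 := rlIntegral_add (α := 1) (t := t) (A := A) (u := E)
          (v := fun s => (-1) * rlIntegral A μ w s)
          (intervalIntegrable_rpow_mul le_rfl (hEc.intervalIntegrable _ _))
          (intervalIntegrable_rpow_mul le_rfl ((hJw t ht).const_mul (-1)))
        rw [rlIntegral_const_mul A 1 t L E] at a1
        rw [rlIntegral_const_mul A 1 t (-1)] at a2
        rw [a1, a2, hrepr t ht]
        ring
      intro s hs t ht hst
      rw [heq s hs, heq t ht]
      have b1 := hm1 hs ht hst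
      have b2 := mul_le_mul_of_nonneg_left (hm2 hs ht hst) hL
      have b3 : c / Real.Gamma (1 - α + 1) * (s - A) ^ (1 - α) ≤
          c / Real.Gamma (1 - α + 1) * (t - A) ^ (1 - α) := by
        refine mul_le_mul_of_nonneg_left ?_
          (div_nonneg hc (Real.Gamma_pos_of_pos (by linarith)).le)
        exact Real.rpow_le_rpow (sub_nonneg.2 hs.1) (by linarith) (by linarith)
      linarith
    intro t ht
    have hbound : L * E t ≤ m / 2 * Real.exp (θ * t) := by
      rw [hE, hθμ, ← mul_assoc, ← mul_assoc]
      refine mul_le_mul_of_nonneg_right ?_ (Real.exp_pos _).le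
      have : L * (1 / (2 * L + 1)) ≤ 1 / 2 := by
        rw [mul_one_div, div_le_div_iff₀ (by linarith) two_pos]
        linarith
      nlinarith
    exact max_le (by linarith [hv t ht]) (by positivity)
  -- The least admissible `m` is the maximum of `w t * exp (-θ t)`; halving it at the maximizer
  -- forces `m = 0`.
  obtain ⟨t₀, ht₀, hmax⟩ := isCompact_Icc.exists_isMaxOn (nonempty_Icc.2 hAB.le)
    (f := fun t => w t * Real.exp (-(θ * t))) (by fun_prop)
  have hw0 : ∀ t, 0 ≤ w t := fun t => le_max_right _ _
  set m := w t₀ * Real.exp (-(θ * t₀)) with hm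
  have hm0 : 0 ≤ m := mul_nonneg (hw0 _) (Real.exp_pos _).le
  have hwm : ∀ t ∈ Icc A B, w t ≤ m * Real.exp (θ * t) := by
    intro t ht
    have h1 : w t * Real.exp (-(θ * t)) ≤ m := hmax ht
    rwa [Real.exp_neg, ← div_eq_mul_inv, div_le_iff₀ (Real.exp_pos _)] at h1
  have hm2 : m ≤ m / 2 := by
    have h1 := hstep m hm0 hwm t₀ ht₀
    rw [← div_le_iff₀ (Real.exp_pos _), div_eq_mul_inv, ← Real.exp_neg] at h1
    exact h1
  intro t ht
  have h1 := hwm t ht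
  rw [show m = 0 by linarith, zero_mul] at h1
  have h2 : -Z t ≤ w t := le_max_left _ _
  linarith

/-! ### The scale `Ψ` and change of variables -/

theorem hasDerivWithinAt_scale {Ψ : ℝ → ℝ} {a b t : ℝ} (hΨ : ContDiffOn ℝ 1 Ψ (Icc a b))
    (ht : t ∈ Icc a b) : HasDerivWithinAt Ψ (scaleDeriv Ψ a b t) (Icc a b) t :=
  (hΨ.differentiableOn one_ne_zero t ht).hasDerivWithinAt

theorem scaleDeriv_pos {Ψ : ℝ → ℝ} {a b t : ℝ} (hmono : MonotoneOn Ψ (Icc a b))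
    (ht : scaleDeriv Ψ a b t ≠ 0) : 0 < scaleDeriv Ψ a b t :=
  lt_of_le_of_ne hmono.derivWithin_nonneg ht.symm

theorem strictMonoOn_scale {Ψ : ℝ → ℝ} {a b : ℝ} (hΨ : ContDiffOn ℝ 1 Ψ (Icc a b))
    (hpos : ∀ t ∈ Icc a b, 0 < scaleDeriv Ψ a b t) : StrictMonoOn Ψ (Icc a b) := by
  refine strictMonoOn_of_deriv_pos (convex_Icc a b) hΨ.continuousOn fun t ht => ?_
  rw [interior_Icc] at ht
  have := (hasDerivWithinAt_scale hΨ (Ioo_subset_Icc_self ht)).hasDerivAt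
    (Icc_mem_nhds ht.1 ht.2)
  rw [this.deriv]
  exact hpos t (Ioo_subset_Icc_self ht)

theorem image_scale_Ioc {Ψ : ℝ → ℝ} {a b t : ℝ} (hc : ContinuousOn Ψ (Icc a b))
    (hmono : StrictMonoOn Ψ (Icc a b)) (ht : t ∈ Icc a b) :
    Ψ '' Ioc a t = Ioc (Ψ a) (Ψ t) := by
  have ha : a ∈ Icc a b := ⟨le_rfl, ht.1.trans ht.2⟩
  have hsub : Icc a t ⊆ Icc a b := Icc_subset_Icc_right ht.2
  ext σ
  constructor
  · rintro ⟨s, hs, rfl⟩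
    have hs' : s ∈ Icc a b := ⟨hs.1.le, hs.2.trans ht.2⟩
    exact ⟨hmono ha hs' hs.1, hmono.monotoneOn hs' ht hs.2⟩
  · intro hσ
    obtain ⟨s, hs, rfl⟩ := intermediate_value_Icc ht.1 (hc.mono hsub) (Ioc_subset_Icc_self hσ)
    refine ⟨s, ⟨lt_of_le_of_ne hs.1 ?_, hs.2⟩, rfl⟩
    rintro rfl
    exact lt_irrefl _ hσ.1

section ChangeOfVariables

variable {Ψ : ℝ → ℝ} {a b : ℝ}

/-- Substitution `σ = Ψ s` for an injective differentiable map; `F` needs no regularity, which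
matters because the derivative inside the Hilfer operator has none. -/
theorem integral_scale (hΨ : ContDiffOn ℝ 1 Ψ (Icc a b))
    (hpos : ∀ t ∈ Icc a b, 0 < scaleDeriv Ψ a b t) {t : ℝ} (ht : t ∈ Icc a b) (F : ℝ → ℝ) :
    ∫ s in a..t, scaleDeriv Ψ a b s * F (Ψ s) = ∫ σ in (Ψ a)..(Ψ t), F σ := by
  have hmono := strictMonoOn_scale hΨ hpos
  have ha : a ∈ Icc a b := ⟨le_rfl, ht.1.trans ht.2⟩
  have hsub : Ioc a t ⊆ Icc a b := fun s hs => ⟨hs.1.le, hs.2.trans ht.2⟩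
  rw [intervalIntegral.integral_of_le ht.1,
    intervalIntegral.integral_of_le (hmono.monotoneOn ha ht ht.1),
    ← image_scale_Ioc hΨ.continuousOn hmono ht,
    integral_image_eq_integral_abs_deriv_smul measurableSet_Ioc
      (fun s hs => (hasDerivWithinAt_scale hΨ (hsub hs)).mono hsub) (hmono.injOn.mono hsub)]
  refine setIntegral_congr_fun measurableSet_Ioc fun s hs => ?_
  simp only [abs_of_pos (hpos s (hsub hs)), smul_eq_mul]

theorem intervalIntegrable_scale (hΨ : ContDiffOn ℝ 1 Ψ (Icc a b))
    (hpos : ∀ t ∈ Icc a b, 0 < scaleDeriv Ψ a b t) {t : ℝ} (ht : t ∈ Icc a b) {F : ℝ → ℝ}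
    (hF : IntervalIntegrable (fun s => scaleDeriv Ψ a b s * F (Ψ s)) volume a t) :
    IntervalIntegrable F volume (Ψ a) (Ψ t) := by
  have hmono := strictMonoOn_scale hΨ hpos
  have ha : a ∈ Icc a b := ⟨le_rfl, ht.1.trans ht.2⟩
  have hsub : Ioc a t ⊆ Icc a b := fun s hs => ⟨hs.1.le, hs.2.trans ht.2⟩
  rw [intervalIntegrable_iff_integrableOn_Ioc_of_le ht.1] at hF
  rw [intervalIntegrable_iff_integrableOn_Ioc_of_le (hmono.monotoneOn ha ht ht.1),
    ← image_scale_Ioc hΨ.continuousOn hmono ht,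
    integrableOn_image_iff_integrableOn_abs_deriv_smul measurableSet_Ioc
      (fun s hs => (hasDerivWithinAt_scale hΨ (hsub hs)).mono hsub) (hmono.injOn.mono hsub)]
  refine hF.congr_fun (fun s hs => ?_) measurableSet_Ioc
  simp only [abs_of_pos (hpos s (hsub hs)), smul_eq_mul]

/-- The fractional integral with respect to `Ψ` is a Riemann-Liouville integral in the
variable `Ψ`. -/
theorem fracIntegral_eq_rlIntegral (hΨ : ContDiffOn ℝ 1 Ψ (Icc a b))
    (hpos : ∀ t ∈ Icc a b, 0 < scaleDeriv Ψ a b t) {t : ℝ} (ht : t ∈ Icc a b) {x X : ℝ → ℝ}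
    (hX : ∀ s ∈ Icc a b, X (Ψ s) = x s) (α : ℝ) :
    fracIntegral Ψ a b α x t = rlIntegral (Ψ a) α X (Ψ t) := by
  unfold fracIntegral rlIntegral
  split_ifs with hα
  · exact (hX t ht).symm
  · rw [← integral_scale hΨ hpos ht]
    congr 1
    refine intervalIntegral.integral_congr fun s hs => ?_
    rw [uIcc_of_le ht.1] at hs
    simp only [fracIntegrand, hX s ⟨hs.1, hs.2.trans ht.2⟩, mul_assoc]

end ChangeOfVariables

/-! ### Linearity of the Hilfer derivative -/

section Linearity

variable {Ψ : ℝ → ℝ} {a b μ ν : ℝ} {x y : ℝ → ℝ}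

theorem fracIntegrand_sub (α t s : ℝ) :
    fracIntegrand Ψ a b α (fun r => x r - y r) t s =
      fracIntegrand Ψ a b α x t s - fracIntegrand Ψ a b α y t s := by
  simp only [fracIntegrand, mul_sub]

theorem FracIntegralExists.sub {α t : ℝ} (hx : FracIntegralExists Ψ a b α x t)
    (hy : FracIntegralExists Ψ a b α y t) :
    FracIntegralExists Ψ a b α (fun r => x r - y r) t := by
  rcases hx with h | hx
  · exact Or.inl h
  · rcases hy with h | hy
    · exact Or.inl h
    · refine Or.inr ?_
      rw [show fracIntegrand Ψ a b α (fun r => x r - y r) t = fun s =>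
        fracIntegrand Ψ a b α x t s - fracIntegrand Ψ a b α y t s from
        funext fun s => fracIntegrand_sub α t s]
      exact hx.sub hy

theorem fracIntegral_sub {α t : ℝ} (hx : FracIntegralExists Ψ a b α x t)
    (hy : FracIntegralExists Ψ a b α y t) :
    fracIntegral Ψ a b α (fun r => x r - y r) t =
      fracIntegral Ψ a b α x t - fracIntegral Ψ a b α y t := by
  by_cases hα : α = 0
  · simp [fracIntegral, hα]
  · simp only [fracIntegral, if_neg hα, fracIntegrand_sub]
    rw [intervalIntegral.integral_sub (hx.resolve_left hα) (hy.resolve_left hα), mul_sub]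

theorem fracIntegral_congr {α t : ℝ} (hat : a < t) (h : ∀ s ∈ Ioc a t, x s = y s) :
    fracIntegral Ψ a b α x t = fracIntegral Ψ a b α y t := by
  unfold fracIntegral
  split_ifs
  · exact h t ⟨hat, le_rfl⟩
  · rw [intervalIntegral.integral_of_le hat.le, intervalIntegral.integral_of_le hat.le]
    congr 1
    exact setIntegral_congr_fun measurableSet_Ioc fun s hs => by
      simp only [fracIntegrand, h s hs]

theorem FracIntegralExists.congr {α t : ℝ} (hat : a ≤ t) (h : ∀ s ∈ Ioc a t, x s = y s)
    (hx : FracIntegralExists Ψ a b α x t) : FracIntegralExists Ψ a b α y t := by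
  refine hx.imp id fun hx => hx.congr fun s hs => ?_
  rw [uIoc_of_le hat] at hs
  simp only [fracIntegrand, h s hs]

/-- The interval of integration is degenerate at `a`. This extends linearity from `(a,b]` to the
whole of `[a,b]`, the set within which derivatives are taken. -/
theorem fracIntegralExists_left (α : ℝ) : FracIntegralExists Ψ a b α x a :=
  Or.inr IntervalIntegrable.refl

theorem HilferDifferentiable.fracIntegral_sub (hx : HilferDifferentiable Ψ a b μ ν x)
    (hy : HilferDifferentiable Ψ a b μ ν y) {t : ℝ} (ht : t ∈ Icc a b) :
    fracIntegral Ψ a b ((1 - ν) * (1 - μ)) (fun r => x r - y r) t =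
      fracIntegral Ψ a b ((1 - ν) * (1 - μ)) x t - fracIntegral Ψ a b ((1 - ν) * (1 - μ)) y t := by
  rcases ht.1.eq_or_lt with rfl | h
  · exact _root_.fracIntegral_sub (fracIntegralExists_left _) (fracIntegralExists_left _)
  · exact _root_.fracIntegral_sub (hx.inner_exists t ⟨h, ht.2⟩) (hy.inner_exists t ⟨h, ht.2⟩)

theorem HilferDifferentiable.hilferInner_sub (hx : HilferDifferentiable Ψ a b μ ν x)
    (hy : HilferDifferentiable Ψ a b μ ν y) {t : ℝ} (ht : t ∈ Ioc a b) :
    hilferInner Ψ a b μ ν (fun r => x r - y r) t =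
      hilferInner Ψ a b μ ν x t - hilferInner Ψ a b μ ν y t := by
  unfold hilferInner
  rw [derivWithin_congr (fun s hs => hx.fracIntegral_sub hy hs)
    (hx.fracIntegral_sub hy ⟨ht.1.le, ht.2⟩),
    derivWithin_fun_sub (hx.differentiable t ht) (hy.differentiable t ht), mul_sub]

theorem HilferDifferentiable.sub (hx : HilferDifferentiable Ψ a b μ ν x)
    (hy : HilferDifferentiable Ψ a b μ ν y) :
    HilferDifferentiable Ψ a b μ ν (fun r => x r - y r) where
  inner_exists t ht := (hx.inner_exists t ht).sub (hy.inner_exists t ht)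
  differentiable t ht := ((hx.differentiable t ht).fun_sub (hy.differentiable t ht)).congr
    (fun _ hs => hx.fracIntegral_sub hy hs) (hx.fracIntegral_sub hy ⟨ht.1.le, ht.2⟩)
  outer_exists t ht := ((hx.outer_exists t ht).sub (hy.outer_exists t ht)).congr ht.1.le
    fun _ hs => (hx.hilferInner_sub hy ⟨hs.1, hs.2.trans ht.2⟩).symm

theorem HilferDifferentiable.hilferDeriv_sub (hx : HilferDifferentiable Ψ a b μ ν x)
    (hy : HilferDifferentiable Ψ a b μ ν y) {t : ℝ} (ht : t ∈ Ioc a b) :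
    hilferDeriv Ψ a b μ ν (fun r => x r - y r) t =
      hilferDeriv Ψ a b μ ν x t - hilferDeriv Ψ a b μ ν y t := by
  unfold hilferDeriv
  rw [fracIntegral_congr ht.1 fun s hs => hx.hilferInner_sub hy ⟨hs.1, hs.2.trans ht.2⟩,
    _root_.fracIntegral_sub (hx.outer_exists t ht) (hy.outer_exists t ht)]

theorem HasInitialValue.sub (hab : a < b) (hx : HilferDifferentiable Ψ a b μ ν x)
    (hy : HilferDifferentiable Ψ a b μ ν y) {c d : ℝ}
    (hc : HasInitialValue Ψ a b ((1 - ν) * (1 - μ)) x c)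
    (hd : HasInitialValue Ψ a b ((1 - ν) * (1 - μ)) y d) :
    HasInitialValue Ψ a b ((1 - ν) * (1 - μ)) (fun r => x r - y r) (c - d) := by
  refine (Tendsto.sub hc hd).congr' ?_
  filter_upwards [Ioc_mem_nhdsGT hab] with t ht
  exact (hx.fracIntegral_sub hy (Ioc_subset_Icc_self ht)).symm

end Linearity

/-! ### Comparison principle for general `Ψ` -/

section Comparison

variable {Ψ : ℝ → ℝ} {a b μ ν : ℝ}

/-- The derivative inside the Hilfer derivative, written with respect to `Ψ`. -/
theorem HilferDifferentiable.hasDerivWithinAt {x : ℝ → ℝ}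
    (hpos : ∀ t ∈ Icc a b, 0 < scaleDeriv Ψ a b t) (hx : HilferDifferentiable Ψ a b μ ν x)
    {t : ℝ} (ht : t ∈ Ioc a b) :
    HasDerivWithinAt (fracIntegral Ψ a b ((1 - ν) * (1 - μ)) x)
      (scaleDeriv Ψ a b t * hilferInner Ψ a b μ ν x t) (Icc a b) t := by
  have h := (hx.differentiable t ht).hasDerivWithinAt
  have hne := (hpos t (Ioc_subset_Icc_self ht)).ne'
  rwa [hilferInner, ← mul_assoc, mul_one_div_cancel hne, one_mul]

/-- The formal value at `a` (zero when the order is nonzero) need not be the limit `c`; replacing it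
by `c` gives the continuity up to `a` that the fundamental theorem of calculus requires. -/
theorem continuousOn_update_fracIntegral {x : ℝ → ℝ}
    (hx : HilferDifferentiable Ψ a b μ ν x) {c : ℝ}
    (hc : HasInitialValue Ψ a b ((1 - ν) * (1 - μ)) x c) :
    ContinuousOn (Function.update (fracIntegral Ψ a b ((1 - ν) * (1 - μ)) x) a c)
      (Icc a b) := by
  rw [continuousOn_update_iff]
  constructor
  · intro t ht
    have ht' : t ∈ Ioc a b := ⟨lt_of_le_of_ne ht.1.1 (Ne.symm ht.2), ht.1.2⟩
    exact (hx.differentiable t ht').continuousWithinAt.mono sdiff_subset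
  · intro _
    exact Tendsto.mono_left hc (nhdsWithin_mono _ fun t ht =>
      lt_of_le_of_ne ht.1.1 (Ne.symm ht.2))

theorem hasDerivAt_update_fracIntegral {x : ℝ → ℝ}
    (hpos : ∀ t ∈ Icc a b, 0 < scaleDeriv Ψ a b t)
    (hx : HilferDifferentiable Ψ a b μ ν x) (c : ℝ) {t : ℝ} (ht : t ∈ Ioo a b) :
    HasDerivAt (Function.update (fracIntegral Ψ a b ((1 - ν) * (1 - μ)) x) a c)
      (scaleDeriv Ψ a b t * hilferInner Ψ a b μ ν x t) t := by
  refine ((hx.hasDerivWithinAt hpos (Ioo_subset_Ioc_self ht)).hasDerivAt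
    (Icc_mem_nhds ht.1 ht.2)).congr_of_eventuallyEq ?_
  filter_upwards [Ioi_mem_nhds ht.1] with s hs
  exact Function.update_of_ne (ne_of_gt hs) _ _

/-- The derivative inside the Hilfer derivative is integrable as soon as the Hilfer derivative
is bounded below. -/
theorem HilferDifferentiable.intervalIntegrable_deriv (hab : a < b)
    (hΨ : ContDiffOn ℝ 1 Ψ (Icc a b)) (hpos : ∀ t ∈ Icc a b, 0 < scaleDeriv Ψ a b t)
    (hμ : 0 < μ) (hν : 0 ≤ (1 - ν) * (1 - μ)) {x : ℝ → ℝ}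
    (hx : HilferDifferentiable Ψ a b μ ν x) {c K : ℝ}
    (hc : HasInitialValue Ψ a b ((1 - ν) * (1 - μ)) x c)
    (hK : ∀ t ∈ Ioc a b, -K ≤ hilferDeriv Ψ a b μ ν x t) :
    IntervalIntegrable (fun s => scaleDeriv Ψ a b s * hilferInner Ψ a b μ ν x s) volume a b := by
  set β := ν * (1 - μ) with hβ
  by_cases hβ0 : β = 0
  · have hΨi : IntervalIntegrable (fun s => scaleDeriv Ψ a b s) volume a b :=
      (ContinuousOn.intervalIntegrable <| by
        rw [uIcc_of_le hab.le]
        exact hΨ.continuousOn_derivWithin (uniqueDiffOn_Icc hab) le_rfl)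
    -- For `β = 0` the inner function is the Hilfer derivative itself, so adding `K Ψ` makes the
    -- derivative nonnegative, and a nonnegative derivative of a continuous function is integrable.
    have hcont := (continuousOn_update_fracIntegral hx hc).add
      (hΨ.continuousOn.const_smul K)
    have hint := intervalIntegral.integrableOn_deriv_of_nonneg hcont
      (g' := fun s => scaleDeriv Ψ a b s * hilferInner Ψ a b μ ν x s + K * scaleDeriv Ψ a b s)
      (fun t ht => (hasDerivAt_update_fracIntegral hpos hx c ht).add
        (((hasDerivWithinAt_scale hΨ (Ioo_subset_Icc_self ht)).hasDerivAt
          (Icc_mem_nhds ht.1 ht.2)).const_smul K))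
      (fun t ht => by
        have h1 := hK t (Ioo_subset_Ioc_self ht)
        rw [hilferDeriv, fracIntegral, if_pos hβ0] at h1
        nlinarith [hpos t (Ioo_subset_Icc_self ht)])
    rw [← intervalIntegrable_iff_integrableOn_Ioc_of_le hab.le] at hint
    refine (hint.sub (hΨi.const_mul K)).congr fun s _ => ?_
    simp
  · have h1 := (hx.outer_exists b ⟨hab, le_rfl⟩).resolve_left hβ0
    -- For `β ≠ 0` the outer integral converges at `b`; since `β < 1`, its weight can be cancelled
    -- by a continuous factor.
    have hc1 : ContinuousOn (fun s => (Ψ b - Ψ s) ^ (1 - β)) (uIcc a b) := by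
      rw [uIcc_of_le hab.le]
      exact (continuousOn_const.sub hΨ.continuousOn).rpow_const
        fun _ _ => Or.inr (by rw [hβ]; nlinarith)
    have h2 := h1.continuousOn_mul hc1
    rw [intervalIntegrable_iff_integrableOn_Ioo_of_le hab.le] at h2 ⊢
    refine h2.congr_fun (fun s hs => ?_) measurableSet_Ioo
    have h3 : 0 < Ψ b - Ψ s := sub_pos.2 <|
      strictMonoOn_scale hΨ hpos (Ioo_subset_Icc_self hs) ⟨hab.le, le_rfl⟩ hs.2
    have h4 : (Ψ b - Ψ s) ^ (1 - β) * (Ψ b - Ψ s) ^ (β - 1) = 1 := by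
      rw [← Real.rpow_add h3]
      simp
    simp only [fracIntegrand]
    linear_combination scaleDeriv Ψ a b s * hilferInner Ψ a b μ ν x s * h4

/-- A continuous function whose Hilfer derivative is bounded below by a multiple of its negative
part is nonnegative, if its initial value is. -/
theorem nonneg_of_hilferDeriv_ge (hab : a < b)
    (hΨ : ContDiffOn ℝ 1 Ψ (Icc a b)) (hpos : ∀ t ∈ Icc a b, 0 < scaleDeriv Ψ a b t)
    (hμ0 : 0 < μ) (hμ1 : μ ≤ 1) (hν0 : 0 ≤ ν) (hν1 : ν ≤ 1) {z : ℝ → ℝ} (hz : Continuous z)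
    (hzD : HilferDifferentiable Ψ a b μ ν z) {c L : ℝ} (hc0 : 0 ≤ c) (hL : 0 ≤ L)
    (hc : HasInitialValue Ψ a b ((1 - ν) * (1 - μ)) z c)
    (hD : ∀ t ∈ Ioc a b, -(L * max (-z t) 0) ≤ hilferDeriv Ψ a b μ ν z t) :
    ∀ t ∈ Icc a b, 0 ≤ z t := by
  have hα : 0 ≤ (1 - ν) * (1 - μ) := mul_nonneg (by linarith) (by linarith)
  have hβ : 0 ≤ ν * (1 - μ) := mul_nonneg hν0 (by linarith)
  have hmono := strictMonoOn_scale hΨ hpos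
  have ha : a ∈ Icc a b := ⟨le_rfl, hab.le⟩
  have hb : b ∈ Icc a b := ⟨hab.le, le_rfl⟩
  obtain ⟨K, hK⟩ : ∃ K, ∀ t ∈ Icc a b, L * max (-z t) 0 ≤ K := by
    obtain ⟨t₀, _, h⟩ := isCompact_Icc.exists_isMaxOn (nonempty_Icc.2 hab.le)
      (f := fun t => L * max (-z t) 0) (by fun_prop)
    exact ⟨_, fun t ht => h ht⟩
  have hint := hzD.intervalIntegrable_deriv hab hΨ hpos hμ0 hα hc (K := K)
    fun t ht => by linarith [hD t ht, hK t (Ioc_subset_Icc_self ht)]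
  have hFTC : ∀ t ∈ Ioc a b, fracIntegral Ψ a b ((1 - ν) * (1 - μ)) z t =
      c + fracIntegral Ψ a b 1 (hilferInner Ψ a b μ ν z) t := by
    intro t ht
    have h1 := intervalIntegral.integral_eq_sub_of_hasDerivAt_of_le ht.1.le
      ((continuousOn_update_fracIntegral hzD hc).mono (Icc_subset_Icc_right ht.2))
      (fun s hs => hasDerivAt_update_fracIntegral hpos hzD c ⟨hs.1, hs.2.trans_le ht.2⟩)
      (hint.mono_set (by
        rw [uIcc_of_le ht.1.le, uIcc_of_le hab.le]; exact Icc_subset_Icc_right ht.2))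
    rw [Function.update_self, Function.update_of_ne ht.1.ne'] at h1
    simp only [fracIntegral, if_neg one_ne_zero, fracIntegrand, sub_self, Real.rpow_zero,
      mul_one, Real.Gamma_one, div_one, one_mul] at h1 ⊢
    rw [h1]
    ring
  -- By Tietze, `z` in the variable `Ψ` extends to a continuous function on the whole line.
  have he : Topology.IsClosedEmbedding fun t : Icc a b => Ψ t :=
    (continuousOn_iff_continuous_domRestrict.1 hΨ.continuousOn).isClosedEmbedding
      (injOn_iff_injective.1 hmono.injOn)
  obtain ⟨Z, hZ⟩ := ContinuousMap.exists_extension he ⟨fun t : Icc a b => z t, by fun_prop⟩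
  have hZ' : ∀ s ∈ Icc a b, Z (Ψ s) = z s := fun s hs => DFunLike.congr_fun hZ ⟨s, hs⟩
  set g : ℝ → ℝ := fun σ => hilferInner Ψ a b μ ν z (Function.invFunOn Ψ (Icc a b) σ) with hg
  have hg' : ∀ s ∈ Icc a b, g (Ψ s) = hilferInner Ψ a b μ ν z s := fun s hs => by
    rw [hg]
    simp only [hmono.injOn.leftInvOn_invFunOn hs]
  have hgi : IntervalIntegrable g volume (Ψ a) (Ψ b) := by
    refine intervalIntegrable_scale hΨ hpos hb (hint.congr fun s hs => ?_)
    rw [uIoc_of_le hab.le] at hs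
    simp only [hg' s (Ioc_subset_Icc_self hs)]
  have himage : ∀ σ ∈ Ioc (Ψ a) (Ψ b), ∃ t ∈ Ioc a b, Ψ t = σ := fun σ hσ => by
    rwa [← image_scale_Ioc hΨ.continuousOn hmono hb] at hσ
  have hcore := nonneg_of_hilfer_inequality (μ := μ) (hmono ha hb hab) hα hβ hμ0 (by ring) hc0 hL
    Z.continuous hgi
    (fun σ hσ => by
      obtain ⟨t, ht, rfl⟩ := himage σ hσ
      have ht' := Ioc_subset_Icc_self ht
      rw [← fracIntegral_eq_rlIntegral hΨ hpos ht' hZ',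
        ← fracIntegral_eq_rlIntegral hΨ hpos ht' hg', hFTC t ht])
    (fun σ hσ => by
      obtain ⟨t, ht, rfl⟩ := himage σ hσ
      have ht' := Ioc_subset_Icc_self ht
      rw [← fracIntegral_eq_rlIntegral hΨ hpos ht' hg', hZ' t ht']
      exact hD t ht)
  intro t ht
  rw [← hZ' t ht]
  exact hcore _ ⟨hmono.monotoneOn ha ht ht.1, hmono.monotoneOn ht hb ht.2⟩

end Comparison

theorem sup_mem_bieleckiSpace {ξ μ a b : ℝ} {Ψ : ℝ → ℝ} {x y : C(Icc a b, ℝ)}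
    (hx : x ∈ bieleckiSpace ξ μ Ψ a b) (hy : y ∈ bieleckiSpace ξ μ Ψ a b) :
    x ⊔ y ∈ bieleckiSpace ξ μ Ψ a b := by
  obtain ⟨M, hM⟩ := hx
  obtain ⟨N, hN⟩ := hy
  refine ⟨max M N, ?_⟩
  rintro _ ⟨t, rfl⟩
  rcases max_choice (x t) (y t) with h | h
  · simpa only [ContinuousMap.sup_apply, h] using (hM ⟨t, rfl⟩).trans (le_max_left M N)
  · simpa only [ContinuousMap.sup_apply, h] using (hN ⟨t, rfl⟩).trans (le_max_right M N)

/-- A monotone operator that is pointwise Lipschitz preserves inequalities at every point. -/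
theorem apply_le_apply_of_pointwise_lipschitz {ξ μ a b L : ℝ} {Ψ : ℝ → ℝ}
    {U : bieleckiSpace ξ μ Ψ a b → bieleckiSpace ξ μ Ψ a b} (hmono : Monotone U)
    (hLip : ∀ (x y : bieleckiSpace ξ μ Ψ a b) (t : Icc a b),
      |(U x).1 t - (U y).1 t| ≤ L * |x.1 t - y.1 t|)
    {x y : bieleckiSpace ξ μ Ψ a b} {t : Icc a b} (h : y.1 t ≤ x.1 t) :
    (U y).1 t ≤ (U x).1 t := by
  -- `x ⊔ y` lies above `y` everywhere and equals `x` at `t`, so `U v` and `U x` agree at `t`.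
  set v : bieleckiSpace ξ μ Ψ a b := ⟨x.1 ⊔ y.1, sup_mem_bieleckiSpace x.2 y.2⟩ with hv
  have h1 : (U y).1 t ≤ (U v).1 t := hmono (show y ≤ v from le_sup_right (a := x.1)) t
  have h2 : v.1 t = x.1 t := by simp [hv, h]
  have h3 := hLip v x t
  rw [h2, sub_self, abs_zero, mul_zero] at h3
  linarith [abs_nonpos_iff.1 h3]

end

theorem theoremt3
    (a b : ℝ) (hab : a < b)
    (Ψ : ℝ → ℝ) (hΨ : ContDiffOn ℝ 1 Ψ (Set.Icc a b)) (hΨmono : MonotoneOn Ψ (Set.Icc a b))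
    (hΨ' : ∀ t ∈ Set.Icc a b, scaleDeriv Ψ a b t ≠ 0)
    (μ ν ε ξ L_f L_U : ℝ) (hμ0 : 0 < μ) (hμ1 : μ ≤ 1) (hν0 : 0 ≤ ν) (hν1 : ν ≤ 1)
    (hε : ε = μ + ν * (1 - μ))
    (hLf : 0 < L_f) (hLU : 0 < L_U) (hξ : L_U + L_f < ξ)
    (f : Set.Icc a b → ℝ → ℝ)
    (hfLip : ∀ (t : Set.Icc a b) (u₁ u₂ : ℝ), |f t u₁ - f t u₂| ≤ L_f * |u₁ - u₂|)
    (hfmono : ∀ t : Set.Icc a b, Monotone (f t))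
    (U : bieleckiSpace ξ μ Ψ a b → bieleckiSpace ξ μ Ψ a b)
    (hUvolterra : IsAbstractVolterra U)
    (hULip : ∀ (x y : bieleckiSpace ξ μ Ψ a b) (t : Set.Icc a b),
      |(U x).1 t - (U y).1 t| ≤ L_U * |x.1 t - y.1 t|)
    (hUmono : Monotone U)
    (x y : bieleckiSpace ξ μ Ψ a b)
    (hxD : HilferDifferentiable Ψ a b μ ν (Set.IccExtend hab.le x.1))
    (hyD : HilferDifferentiable Ψ a b μ ν (Set.IccExtend hab.le y.1))
    (hx : ∀ t : Set.Icc a b, a < t →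
      hilferDeriv Ψ a b μ ν (Set.IccExtend hab.le x.1) t = (U x).1 t + f t (x.1 t))
    (hy : ∀ t : Set.Icc a b, a < t →
      hilferDeriv Ψ a b μ ν (Set.IccExtend hab.le y.1) t ≤ (U y).1 t + f t (y.1 t))
    (x₀ y₀ : ℝ)
    (hx₀ : HasInitialValue Ψ a b (1 - ε) (Set.IccExtend hab.le x.1) x₀)
    (hy₀ : HasInitialValue Ψ a b (1 - ε) (Set.IccExtend hab.le y.1) y₀)
    (h₀ : y₀ ≤ x₀) :
    y ≤ x := by
  have hpos : ∀ t ∈ Set.Icc a b, 0 < scaleDeriv Ψ a b t := fun t ht =>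
    scaleDeriv_pos hΨmono (hΨ' t ht)
  have horder : 1 - ε = (1 - ν) * (1 - μ) := by rw [hε]; ring
  rw [horder] at hx₀ hy₀
  have hL : 0 ≤ L_U + L_f := by linarith
  have hz := nonneg_of_hilferDeriv_ge hab hΨ hpos hμ0 hμ1 hν0 hν1
    (z := fun r => Set.IccExtend hab.le x.1 r - Set.IccExtend hab.le y.1 r)
    (x.1.continuous.Icc_extend'.sub y.1.continuous.Icc_extend') (hxD.sub hyD)
    (sub_nonneg.2 h₀) hL (HasInitialValue.sub hab hxD hyD hx₀ hy₀) fun t ht => by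
      have ht' := Set.Ioc_subset_Icc_self ht
      rw [hxD.hilferDeriv_sub hyD ht, hx ⟨t, ht'⟩ ht.1, Set.IccExtend_of_mem _ _ ht',
        Set.IccExtend_of_mem _ _ ht']
      have hy' := hy ⟨t, ht'⟩ ht.1
      have hU := hULip x y ⟨t, ht'⟩
      have hf := hfLip ⟨t, ht'⟩ (x.1 ⟨t, ht'⟩) (y.1 ⟨t, ht'⟩)
      -- If `y ≤ x` at `t`, monotonicity makes both increments nonnegative; otherwise the Lipschitz
      -- bounds give exactly `-(L_U + L_f)` times the negative part.
      rcases le_total (y.1 ⟨t, ht'⟩) (x.1 ⟨t, ht'⟩) with h | h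
      · rw [max_eq_right (by linarith)]
        linarith [hfmono ⟨t, ht'⟩ h, apply_le_apply_of_pointwise_lipschitz hUmono hULip h]
      · rw [max_eq_left (by linarith)]
        rw [abs_of_nonpos (sub_nonpos.2 h)] at hU hf
        linarith [neg_abs_le ((U x).1 ⟨t, ht'⟩ - (U y).1 ⟨t, ht'⟩),
          neg_abs_le (f ⟨t, ht'⟩ (x.1 ⟨t, ht'⟩) - f ⟨t, ht'⟩ (y.1 ⟨t, ht'⟩))]
  intro t
  have h := hz t t.2
  rw [Set.IccExtend_val, Set.IccExtend_val] at h
  exact sub_nonneg.1 h
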